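/- Let $\mathbb{K}$ be $\mathbb{R}$ or $\mathbb{C}$; all spaces are over $\mathbb{K}$. A pair $(X,Y)$ of Banach spaces has the Bishop–Phelps–Bollobás property (BPBp) for compact operators if for every $\varepsilon>0$ there is $\eta(\varepsilon)>0$ such that whenever $T:X\to Y$ is a compact linear operator with $\|T\|=1$ and $x_0\in X$ satisfies $\|x_0\|=1$ and $\|T x_0\|>1-\eta(\varepsilon)$, there are a compact linear operator $S:X\to Y$ and $x_1\in X$ with $\|x_1\|=1$ such that $$\|S\|=\|S x_1\|=1,\qquad \|x_0-x_1\|<\varepsilon,\qquad \|S-T\|<\varepsilon .$$ Let $c_0$ be the space of scalar sequences converging to zero, and for a locally compact Hausdorff space $L$ let $C_0(L)$ be the space of continuous functions $L\to\mathbb{K}$ vanishing at infinity, both with the supremum norm. **Theorem.** Let $L$ be a locally compact Hausdorff topological space and let $Y$ be a Banach space. If $(c_0,Y)$ has the BPBp for compact operators, then $(C_0(L),Y)$ has the BPBp for compact operators. -/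

import Mathlib

open scoped ZeroAtInfty

/-- The pair `(X, Y)` of normed spaces over `𝕜` has the Bishop-Phelps-Bollobás property for
compact operators: for every `ε > 0` there is `η > 0` such that every norm-one compact operator
`T : X → Y` and every unit vector `x₀` with `‖T x₀‖ > 1 - η` can be `ε`-approximated by a norm-one
compact operator `S` and a unit vector `x₁` at which `S` attains its norm. -/
def HasBPBpCompact (𝕜 : Type*) [RCLike 𝕜]
    (X : Type*) [NormedAddCommGroup X] [NormedSpace 𝕜 X]
    (Y : Type*) [NormedAddCommGroup Y] [NormedSpace 𝕜 Y] : Prop :=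
  ∀ ε : ℝ, 0 < ε → ∃ η : ℝ, 0 < η ∧
    ∀ (T : X →L[𝕜] Y) (x₀ : X), IsCompactOperator T → ‖T‖ = 1 → ‖x₀‖ = 1 → 1 - η < ‖T x₀‖ →
      ∃ (S : X →L[𝕜] Y) (x₁ : X), IsCompactOperator S ∧ ‖x₁‖ = 1 ∧
        ‖S‖ = 1 ∧ ‖S x₁‖ = 1 ∧ ‖x₀ - x₁‖ < ε ∧ ‖S - T‖ < ε

/-- The Banach space `c₀` of scalar sequences converging to zero, with the supremum norm, as the
functions on the discrete space `ℕ` vanishing at infinity (see `exists_c0_iff_tendsto` and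
`c0_isLUB_norm`). -/
abbrev c0 (𝕜 : Type*) [RCLike 𝕜] : Type _ := C₀(ℕ, 𝕜)

/-- The elements of `c0 𝕜` are exactly the sequences that converge to zero. -/
theorem exists_c0_iff_tendsto {𝕜 : Type*} [RCLike 𝕜] (a : ℕ → 𝕜) :
    (∃ f : c0 𝕜, ⇑f = a) ↔ Filter.Tendsto a Filter.atTop (nhds 0) := by
  have h : Filter.cocompact ℕ = Filter.atTop := by
    rw [Filter.cocompact_eq_cofinite, Nat.cofinite_eq_atTop]
  constructor
  · rintro ⟨f, rfl⟩
    exact h ▸ f.zero_at_infty'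
  · intro ha
    exact ⟨⟨⟨a, continuous_of_discreteTopology⟩, h.symm ▸ ha⟩, rfl⟩

/-- The norm of `c0 𝕜` is the supremum norm. -/
theorem c0_isLUB_norm {𝕜 : Type*} [RCLike 𝕜] (f : c0 𝕜) :
    IsLUB (Set.range fun n => ‖f n‖) ‖f‖ := by
  rw [← ZeroAtInftyContinuousMap.norm_toBCF_eq_norm]
  constructor
  · rintro _ ⟨n, rfl⟩
    exact f.toBCF.norm_coe_le_norm n
  · intro b hb
    have hb' : ∀ n, ‖f n‖ ≤ b := fun n => hb ⟨n, rfl⟩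
    exact (BoundedContinuousFunction.norm_le ((norm_nonneg _).trans (hb' 0))).2 hb'

/-!
The space `C₀(L)` looks like `ℓ_∞^ι` with `ι` finite, as far as one compact operator `T` and one
function `x₀` can tell: there are contractions `Q : C₀(L) → ℓ_∞^ι` and `J : ℓ_∞^ι → C₀(L)` with
`Q ∘ J = id` such that `J (Q x₀)` is close to `x₀` and `T ∘ J ∘ Q` is close to `T`
(`IsCompactOperator.exists_pi_factorization`). The pairs `(ℓ_∞^ι, Y)` inherit the property from
`(c₀, Y)` with the same `η` for all `ι` (`HasBPBpCompact.exists_pi`). Applied to `T ∘ J` and `Q x₀`,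
this yields `S` and `u`, and then `S ∘ Q` attains its norm at `J u`, precisely because
`Q (J u) = u`.

For the factorization, compactness of `T` reduces the closeness of `T ∘ J ∘ Q` and `T` to finitely
many functionals on `C₀(L)` (`IsCompactOperator.exists_finset_functional`). These are dominated by
one finite regular measure `μ`, obtained from their total variations by the Riesz-Markov-Kakutani
theorem (`exists_measure_dominating`), and so they are approximated by functionals
`g ↦ ∫ h * g ∂μ` with `h` in `C₀(L)` (`exists_approx_density`). It remains to treat finitely many
functions `h` together with `x₀` (`exists_pi_factorization`). A partition of unity `φ i` is chosen
on whose supports all of these oscillate little, and such that `φ i = 1` on a compact plateau `K i`,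
the plateaus carrying almost all of the relevant mass (`PlateauPartition.exists_subordinate`).
`J u = ∑ i, u i • φ i`, and `Q` takes the means over the plateaus. A function `w` with `Q w = 0` has
integral zero over each plateau, where `h` is almost constant; hence `∫ h * w ∂μ` is small
(`PlateauPartition.norm_integral_mul_le`).
-/

section

open scoped NNReal CompactlySupported
open MeasureTheory

/-! ### The supremum norm of `C₀(X)` -/

theorem ZeroAtInftyContinuousMap.norm_apply_le {X 𝕜 : Type*} [TopologicalSpace X]
    [NormedAddCommGroup 𝕜] (f : C₀(X, 𝕜)) (x : X) : ‖f x‖ ≤ ‖f‖ := by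
  rw [← ZeroAtInftyContinuousMap.norm_toBCF_eq_norm]
  exact f.toBCF.norm_coe_le_norm x

theorem ZeroAtInftyContinuousMap.norm_le_of_forall {X 𝕜 : Type*} [TopologicalSpace X]
    [NormedAddCommGroup 𝕜] {f : C₀(X, 𝕜)} {r : ℝ} (hr : 0 ≤ r) (h : ∀ x, ‖f x‖ ≤ r) :
    ‖f‖ ≤ r := by
  rw [← ZeroAtInftyContinuousMap.norm_toBCF_eq_norm]
  exact (BoundedContinuousFunction.norm_le hr).2 h

/-! ### Finite coordinate blocks of `c₀` -/

/-- Reading off finitely many coordinates of a sequence in `c₀`. -/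
noncomputable def c0Restrict (𝕜 : Type*) [RCLike 𝕜] {ι : Type*} [Fintype ι] (e : ι → ℕ) :
    c0 𝕜 →L[𝕜] (ι → 𝕜) :=
  LinearMap.mkContinuous
    { toFun := fun f i => f (e i)
      map_add' := fun _ _ => rfl
      map_smul' := fun _ _ => rfl } 1 fun f => by
    rw [one_mul]
    exact (pi_norm_le_iff_of_nonneg (norm_nonneg f)).2 fun i => f.norm_apply_le (e i)

/-- Extension by zero of a finitely supported family to a sequence in `c₀`. -/
noncomputable def c0Extend (𝕜 : Type*) [RCLike 𝕜] {ι : Type*} [Fintype ι] (e : ι ↪ ℕ) :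
    (ι → 𝕜) →L[𝕜] c0 𝕜 :=
  LinearMap.mkContinuous
    { toFun := fun u =>
        { toFun := Function.extend e u 0
          continuous_toFun := continuous_of_discreteTopology
          zero_at_infty' := by
            rw [Filter.cocompact_eq_cofinite]
            refine tendsto_nhds_of_eventually_eq ?_
            filter_upwards [(Set.finite_range e).compl_mem_cofinite] with n hn
            exact Function.extend_apply' _ _ _ hn }
      map_add' := fun u v => by
        ext n
        change Function.extend e (u + v) 0 n = Function.extend e u 0 n + Function.extend e v 0 n
        rw [← Pi.add_apply, ← Function.extend_add, add_zero]
      map_smul' := fun c u => by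
        ext n
        change Function.extend e (c • u) 0 n = c • Function.extend e u 0 n
        rw [← Pi.smul_apply, ← Function.extend_smul, smul_zero] } 1 fun u => by
    rw [one_mul]
    refine ZeroAtInftyContinuousMap.norm_le_of_forall (norm_nonneg u) fun n => ?_
    change ‖Function.extend e u 0 n‖ ≤ ‖u‖
    by_cases hn : ∃ i, e i = n
    · obtain ⟨i, rfl⟩ := hn
      rw [e.injective.extend_apply]
      exact norm_le_pi_norm u i
    · rw [Function.extend_apply' _ _ _ hn]
      simp

section
variable {𝕜 : Type*} [RCLike 𝕜] {ι : Type*} [Fintype ι]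

theorem c0Extend_apply (e : ι ↪ ℕ) (u : ι → 𝕜) (i : ι) : c0Extend 𝕜 e u (e i) = u i :=
  e.injective.extend_apply _ _ _

theorem c0Extend_apply_of_notMem (e : ι ↪ ℕ) (u : ι → 𝕜) {n : ℕ} (hn : n ∉ Set.range e) :
    c0Extend 𝕜 e u n = 0 :=
  Function.extend_apply' _ _ _ hn

theorem c0Restrict_c0Extend (e : ι ↪ ℕ) (u : ι → 𝕜) : c0Restrict 𝕜 e (c0Extend 𝕜 e u) = u :=
  funext fun i => c0Extend_apply e u i

theorem norm_c0Restrict_le (e : ι → ℕ) (f : c0 𝕜) : ‖c0Restrict 𝕜 e f‖ ≤ ‖f‖ :=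
  (pi_norm_le_iff_of_nonneg (norm_nonneg f)).2 fun i => f.norm_apply_le (e i)

theorem norm_c0Extend (e : ι ↪ ℕ) (u : ι → 𝕜) : ‖c0Extend 𝕜 e u‖ = ‖u‖ := by
  apply le_antisymm
  · refine ZeroAtInftyContinuousMap.norm_le_of_forall (norm_nonneg u) fun n => ?_
    by_cases hn : n ∈ Set.range e
    · obtain ⟨i, rfl⟩ := hn
      rw [c0Extend_apply]
      exact norm_le_pi_norm u i
    · rw [c0Extend_apply_of_notMem e u hn]
      simp
  · conv_lhs => rw [← c0Restrict_c0Extend e u]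
    exact norm_c0Restrict_le _ _

/-- An operator defined on a finite-dimensional space is compact. -/
theorem isCompactOperator_of_finiteDimensional_domain {E Y : Type*} [NormedAddCommGroup E]
    [NormedSpace 𝕜 E] [FiniteDimensional 𝕜 E] [NormedAddCommGroup Y] [NormedSpace 𝕜 Y]
    (S : E →L[𝕜] Y) : IsCompactOperator S :=
  have h : IsCompactOperator (_root_.id : E → E) :=
    (isCompactOperator_id_iff_finiteDimensional (𝕜 := 𝕜)).2 ‹_›
  h.clm_comp S

/-- If a contraction `S` on `c₀` attains norm one at `x` and the coordinates of `x` outside the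
range of `e` stay below `1` in modulus, then `S` already attains norm one at the truncation of `x`
to the range of `e`: the point `x` lies in the interior of a segment of the unit ball through the
truncation, and `S` cannot be smaller at an interior point than at both ends. -/
theorem one_le_norm_map_truncation {Y : Type*} [NormedAddCommGroup Y] [NormedSpace 𝕜 Y]
    (e : ι ↪ ℕ) {S : c0 𝕜 →L[𝕜] Y} (hS : ‖S‖ ≤ 1) {x : c0 𝕜} (hx : ‖x‖ ≤ 1) (hSx : ‖S x‖ = 1)
    {r : ℝ} (hr0 : 0 < r) (hr : r ≤ 1) (htail : ∀ n ∉ Set.range e, ‖x n‖ ≤ 1 - r) :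
    1 ≤ ‖S (c0Extend 𝕜 e (c0Restrict 𝕜 e x))‖ := by
  set u := c0Extend 𝕜 e (c0Restrict 𝕜 e x) with hu
  -- `x` is the convex combination `r • u + (1 - r) • z` with `z = u + (1 - r)⁻¹ • (x - u)`;
  -- to avoid the division, bound `(1 - r) • z` directly.
  have hz : ‖x - (r : 𝕜) • u‖ ≤ 1 - r := by
    refine ZeroAtInftyContinuousMap.norm_le_of_forall (by linarith) fun n => ?_
    change ‖x n - (r : 𝕜) * u n‖ ≤ 1 - r
    by_cases hn : n ∈ Set.range e
    · obtain ⟨i, rfl⟩ := hn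
      have h1 : u (e i) = x (e i) := c0Extend_apply e _ i
      have h2 : x (e i) - (r : 𝕜) * x (e i) = ((1 - r : ℝ) : 𝕜) * x (e i) := by
        push_cast; ring
      rw [h1, h2, norm_mul, RCLike.norm_ofReal, abs_of_nonneg (by linarith)]
      have := (x.norm_apply_le (e i)).trans hx
      nlinarith
    · rw [hu, c0Extend_apply_of_notMem e _ hn, mul_zero, sub_zero]
      exact htail n hn
  have h1 : ‖S (x - (r : 𝕜) • u)‖ ≤ 1 - r := by
    have := S.le_of_opNorm_le hS (x - (r : 𝕜) • u)
    linarith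
  have h2 : S x = S (x - (r : 𝕜) • u) + (r : 𝕜) • S u := by
    rw [map_sub, map_smul, sub_add_cancel]
  have h3 : 1 ≤ ‖S (x - (r : 𝕜) • u)‖ + r * ‖S u‖ := by
    calc 1 = ‖S x‖ := hSx.symm
      _ ≤ ‖S (x - (r : 𝕜) • u)‖ + ‖(r : 𝕜) • S u‖ := by rw [h2]; exact norm_add_le _ _
      _ = _ := by rw [norm_smul, RCLike.norm_ofReal, abs_of_pos hr0]
  have h4 : r * 1 ≤ r * ‖S u‖ := by linarith
  exact le_of_mul_le_mul_left h4 hr0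

end

/-! ### The property for `(ℓ_∞^ι, Y)` with `ι` finite -/

theorem norm_normalize_and_norm_sub_normalize {𝕜 : Type*} [RCLike 𝕜] {E : Type*}
    [NormedAddCommGroup E] [NormedSpace 𝕜 E] {v : E} (hv : 0 < ‖v‖) (hv1 : ‖v‖ ≤ 1) :
    ‖((‖v‖⁻¹ : ℝ) : 𝕜) • v‖ = 1 ∧ ‖v - ((‖v‖⁻¹ : ℝ) : 𝕜) • v‖ = 1 - ‖v‖ := by
  have h1 : 1 ≤ ‖v‖⁻¹ := (one_le_inv₀ hv).2 hv1
  constructor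
  · rw [norm_smul, RCLike.norm_ofReal, abs_of_nonneg (by positivity), inv_mul_cancel₀ hv.ne']
  · have : v - ((‖v‖⁻¹ : ℝ) : 𝕜) • v = ((1 - ‖v‖⁻¹ : ℝ) : 𝕜) • v := by
      push_cast; rw [sub_smul, one_smul]
    rw [this, norm_smul, RCLike.norm_ofReal, abs_sub_comm, abs_of_nonneg (by linarith), sub_mul,
      inv_mul_cancel₀ hv.ne', one_mul]

/-- The Bishop-Phelps-Bollobás property allows operators and vectors of norm at most one, rather
than equal to one: they are almost normalized as soon as `‖T x₀‖` is close to one. -/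
theorem HasBPBpCompact.exists_of_norm_le_one {𝕜 : Type*} [RCLike 𝕜]
    {X : Type*} [NormedAddCommGroup X] [NormedSpace 𝕜 X]
    {Y : Type*} [NormedAddCommGroup Y] [NormedSpace 𝕜 Y]
    (h : HasBPBpCompact 𝕜 X Y) {ε : ℝ} (hε : 0 < ε) :
    ∃ η : ℝ, 0 < η ∧ ∀ (T : X →L[𝕜] Y) (x₀ : X), IsCompactOperator T → ‖T‖ ≤ 1 → ‖x₀‖ ≤ 1 →
      1 - η < ‖T x₀‖ → ∃ (S : X →L[𝕜] Y) (x₁ : X), ‖x₁‖ = 1 ∧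
        ‖S‖ = 1 ∧ ‖S x₁‖ = 1 ∧ ‖x₀ - x₁‖ < ε ∧ ‖S - T‖ < ε := by
  obtain ⟨η, hη, H⟩ := h (ε / 2) (half_pos hε)
  have hm : 0 < min (min η (ε / 2)) 1 := by positivity
  refine ⟨min (min η (ε / 2)) 1, hm, fun T x₀ hTc hT hx₀ hTx => ?_⟩
  have hη1 : min (min η (ε / 2)) 1 ≤ η := (min_le_left _ _).trans (min_le_left _ _)
  have hη2 : min (min η (ε / 2)) 1 ≤ ε / 2 := (min_le_left _ _).trans (min_le_right _ _)
  have hη3 : min (min η (ε / 2)) 1 ≤ 1 := min_le_right _ _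
  set m := min (min η (ε / 2)) 1
  have hle : ‖T x₀‖ ≤ ‖T‖ * ‖x₀‖ := T.le_opNorm x₀
  have hT1 : 1 - m < ‖T‖ := by nlinarith [norm_nonneg T, norm_nonneg x₀]
  have hx1 : 1 - m < ‖x₀‖ := by nlinarith [norm_nonneg T, norm_nonneg x₀]
  have hTpos : 0 < ‖T‖ := by linarith
  have hxpos : 0 < ‖x₀‖ := by linarith
  have keyX := norm_normalize_and_norm_sub_normalize (𝕜 := 𝕜) hxpos hx₀
  have keyT := norm_normalize_and_norm_sub_normalize (𝕜 := 𝕜) hTpos hT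
  have hc : IsCompactOperator (((‖T‖⁻¹ : ℝ) : 𝕜) • T) := hTc.smul _
  obtain ⟨S, x₁, -, hx₁, hS, hSx, hd, hST⟩ := H _ _ hc keyT.1 keyX.1 (by
    rw [smul_apply, map_smul, norm_smul, norm_smul, RCLike.norm_ofReal,
      RCLike.norm_ofReal, abs_of_pos (inv_pos.2 hTpos), abs_of_pos (inv_pos.2 hxpos)]
    have h1 : 1 ≤ ‖T‖⁻¹ := (one_le_inv₀ hTpos).2 hT
    have h2 : 1 ≤ ‖x₀‖⁻¹ := (one_le_inv₀ hxpos).2 hx₀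
    have h3 : ‖T x₀‖ ≤ ‖x₀‖⁻¹ * ‖T x₀‖ := le_mul_of_one_le_left (norm_nonneg _) h2
    have h4 : ‖x₀‖⁻¹ * ‖T x₀‖ ≤ ‖T‖⁻¹ * (‖x₀‖⁻¹ * ‖T x₀‖) :=
      le_mul_of_one_le_left (by positivity) h1
    linarith)
  refine ⟨S, x₁, hx₁, hS, hSx, ?_, ?_⟩
  · have := norm_sub_le_norm_sub_add_norm_sub x₀ (((‖x₀‖⁻¹ : ℝ) : 𝕜) • x₀) x₁
    linarith [keyX.2]
  · have := norm_sub_le_norm_sub_add_norm_sub S (((‖T‖⁻¹ : ℝ) : 𝕜) • T) T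
    rw [norm_sub_rev (((‖T‖⁻¹ : ℝ) : 𝕜) • T) T] at this
    linarith [keyT.2]

/-- The property for `(c₀, Y)` gives the property for the pairs `(ℓ_∞^ι, Y)` with `ι` finite,
uniformly in `ι`: compose with the coordinate projection of `c₀` onto `ℓ_∞^ι`. -/
theorem HasBPBpCompact.exists_pi {𝕜 : Type*} [RCLike 𝕜]
    {Y : Type*} [NormedAddCommGroup Y] [NormedSpace 𝕜 Y]
    (h : HasBPBpCompact 𝕜 (c0 𝕜) Y) {ε : ℝ} (hε : 0 < ε) :
    ∃ η : ℝ, 0 < η ∧ ∀ (ι : Type) [Fintype ι] (T : (ι → 𝕜) →L[𝕜] Y) (x₀ : ι → 𝕜),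
      ‖T‖ ≤ 1 → ‖x₀‖ ≤ 1 → 1 - η < ‖T x₀‖ →
      ∃ (S : (ι → 𝕜) →L[𝕜] Y) (x₁ : ι → 𝕜), ‖x₁‖ ≤ 1 ∧
        ‖S‖ ≤ 1 ∧ ‖S x₁‖ = 1 ∧ ‖x₀ - x₁‖ < ε ∧ ‖S - T‖ < ε := by
  -- The coordinates outside `ℓ_∞^ι` of a vector near `x₀` are at most `1 / 2`.
  obtain ⟨η, hη, H⟩ := h.exists_of_norm_le_one (ε := min ε (1 / 2)) (by positivity)
  refine ⟨η, hη, fun ι _ T x₀ hT hx₀ hTx => ?_⟩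
  obtain ⟨e, he⟩ := exists_injective_nat ι
  let e : ι ↪ ℕ := ⟨e, he⟩
  have hR : ‖c0Restrict 𝕜 e‖ ≤ 1 := ContinuousLinearMap.opNorm_le_bound _ zero_le_one fun f => by
    rw [one_mul]; exact norm_c0Restrict_le e f
  have hE : ‖c0Extend 𝕜 e‖ ≤ 1 := ContinuousLinearMap.opNorm_le_bound _ zero_le_one fun u => by
    rw [one_mul, norm_c0Extend]
  obtain ⟨S, x₁, hx₁, hS, hSx, hd, hST⟩ := H (T ∘L c0Restrict 𝕜 e) (c0Extend 𝕜 e x₀)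
    ((isCompactOperator_of_finiteDimensional_domain T).comp_clm _)
    ((T.opNorm_comp_le _).trans (mul_le_one₀ hT (norm_nonneg _) hR))
    ((norm_c0Extend e x₀).trans_le hx₀)
    (by rwa [ContinuousLinearMap.comp_apply, c0Restrict_c0Extend])
  have hSE : ‖S ∘L c0Extend 𝕜 e‖ ≤ 1 :=
    (S.opNorm_comp_le _).trans (mul_le_one₀ hS.le (norm_nonneg _) hE)
  have hx₁' : ‖c0Restrict 𝕜 e x₁‖ ≤ 1 := (norm_c0Restrict_le e x₁).trans hx₁.le
  refine ⟨S ∘L c0Extend 𝕜 e, c0Restrict 𝕜 e x₁, hx₁', hSE, le_antisymm ?_ ?_, ?_, ?_⟩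
  · exact (ContinuousLinearMap.le_of_opNorm_le_of_le _ hSE hx₁').trans (by norm_num)
  · refine one_le_norm_map_truncation e hS.le hx₁.le hSx (r := 1 / 2) (by norm_num) (by norm_num)
      fun n hn => ?_
    have h1 := (c0Extend 𝕜 e x₀ - x₁).norm_apply_le n
    rw [ZeroAtInftyContinuousMap.sub_apply, c0Extend_apply_of_notMem e x₀ hn, zero_sub,
      norm_neg] at h1
    linarith [min_le_right ε (1 / 2)]
  · have h1 := norm_c0Restrict_le e (c0Extend 𝕜 e x₀ - x₁)
    rw [map_sub, c0Restrict_c0Extend] at h1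
    exact h1.trans_lt (hd.trans_le (min_le_left _ _))
  · have h1 : S ∘L c0Extend 𝕜 e - T = (S - T ∘L c0Restrict 𝕜 e) ∘L c0Extend 𝕜 e := by
      ext1 u
      simp [c0Restrict_c0Extend]
    rw [h1]
    refine (ContinuousLinearMap.opNorm_comp_le _ _).trans_lt ?_
    exact (mul_le_of_le_one_right (norm_nonneg _) hE).trans_lt (hST.trans_le (min_le_left _ _))

/-! ### Compact operators and finitely many functionals -/

/-- A compact operator is normed, up to `δ`, by finitely many functionals: the compositions of `T`
with norming functionals of the points of a finite net of the image of the unit ball. -/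
theorem IsCompactOperator.exists_finset_functional {𝕜 : Type*} [RCLike 𝕜]
    {X : Type*} [NormedAddCommGroup X] [NormedSpace 𝕜 X]
    {Y : Type*} [NormedAddCommGroup Y] [NormedSpace 𝕜 Y]
    {T : X →L[𝕜] Y} (hT : IsCompactOperator T) {δ : ℝ} (hδ : 0 < δ) :
    ∃ s : Finset (X →L[𝕜] 𝕜), ∀ w, ‖w‖ ≤ 1 → ∃ F ∈ s, ‖T w‖ ≤ ‖F w‖ + δ := by
  classical
  have htb : TotallyBounded (T '' Metric.closedBall 0 1) :=
    (hT.isCompact_closure_image_of_bounded (f := T.toLinearMap)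
      Metric.isBounded_closedBall).totallyBounded.subset subset_closure
  obtain ⟨t, -, htf, ht⟩ := Metric.finite_approx_of_totallyBounded htb (δ / 2) (half_pos hδ)
  choose φ hφ1 hφ2 using fun z : Y => exists_dual_vector'' 𝕜 z
  refine ⟨htf.toFinset.image fun z => φ z ∘L T, fun w hw => ?_⟩
  obtain ⟨z, hz, hzw⟩ := Set.mem_iUnion₂.1 (ht ⟨w, by simpa using hw, rfl⟩)
  refine ⟨φ z ∘L T, Finset.mem_image_of_mem _ (htf.mem_toFinset.2 hz), ?_⟩
  rw [Metric.mem_ball, dist_eq_norm] at hzw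
  have h1 : ‖T w‖ ≤ ‖z‖ + ‖T w - z‖ := norm_le_norm_add_norm_sub' _ _
  have h2 : ‖z‖ = ‖φ z z‖ := by rw [hφ2]; simp
  have h3 : ‖φ z z‖ ≤ ‖φ z (T w)‖ + ‖φ z (T w - z)‖ := by
    rw [map_sub, norm_sub_rev]; exact norm_le_norm_add_norm_sub' _ _
  have h4 : ‖φ z (T w - z)‖ ≤ ‖T w - z‖ := by
    simpa using (φ z).le_of_opNorm_le (hφ1 z) (T w - z)
  rw [ContinuousLinearMap.comp_apply]
  linarith

/-! ### Total variation of a functional on `C₀(L)` -/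

section
variable {𝕜 : Type*} [RCLike 𝕜] {L : Type*} [TopologicalSpace L]

theorem nnnorm_ofReal_coe (r : ℝ≥0) : ‖((r : ℝ) : 𝕜)‖₊ = r :=
  NNReal.eq (by rw [coe_nnnorm, RCLike.norm_ofReal, abs_of_nonneg r.coe_nonneg])

/-- The function `g * f₁ / (f₁ + f₂)`, the part of `g` dominated by `f₁` when `g` is dominated
by `f₁ + f₂`. -/
noncomputable def dominatedPart (g : C₀(L, 𝕜)) (f₁ f₂ : C_c(L, ℝ≥0))
    (h : ∀ x, ‖g x‖₊ ≤ f₁ x + f₂ x) : C₀(L, 𝕜) where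
  toFun x := (((f₁ x / (f₁ x + f₂ x) : ℝ≥0) : ℝ) : 𝕜) * g x
  continuous_toFun := by
    rw [continuous_iff_continuousAt]
    intro x
    by_cases hx : f₁ x + f₂ x = 0
    · have hgx : g x = 0 := by simpa [hx] using h x
      have h0 : Filter.Tendsto (fun y => ‖g y‖) (nhds x) (nhds 0) := by
        have := (map_continuous g).norm.tendsto x
        rwa [hgx, norm_zero] at this
      unfold ContinuousAt
      simp only [hgx, mul_zero]
      refine squeeze_zero_norm (fun y => ?_) h0
      rw [norm_mul, RCLike.norm_ofReal, abs_of_nonneg (NNReal.coe_nonneg _)]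
      refine mul_le_of_le_one_left (norm_nonneg _) ?_
      exact_mod_cast div_le_one_of_le₀ (le_add_of_nonneg_right zero_le) zero_le
    · have h1 : ContinuousAt (fun y => f₁ y / (f₁ y + f₂ y)) x :=
        (map_continuous f₁).continuousAt.div
          ((map_continuous f₁).add (map_continuous f₂)).continuousAt hx
      exact (RCLike.continuous_ofReal.continuousAt.comp
        (NNReal.continuous_coe.continuousAt.comp h1)).mul (map_continuous g).continuousAt
  zero_at_infty' := by
    have h0 : Filter.Tendsto (fun y => ‖g y‖) (Filter.cocompact L) (nhds 0) := by
      simpa using (zero_at_infty g).norm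
    refine squeeze_zero_norm (fun y => ?_) h0
    rw [norm_mul, RCLike.norm_ofReal, abs_of_nonneg (NNReal.coe_nonneg _)]
    refine mul_le_of_le_one_left (norm_nonneg _) ?_
    exact_mod_cast div_le_one_of_le₀ (le_add_of_nonneg_right zero_le) zero_le

theorem nnnorm_dominatedPart_le (g : C₀(L, 𝕜)) (f₁ f₂ : C_c(L, ℝ≥0))
    (h : ∀ x, ‖g x‖₊ ≤ f₁ x + f₂ x) (x : L) : ‖dominatedPart g f₁ f₂ h x‖₊ ≤ f₁ x := by
  change ‖(((f₁ x / (f₁ x + f₂ x) : ℝ≥0) : ℝ) : 𝕜) * g x‖₊ ≤ f₁ x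
  rw [nnnorm_mul, nnnorm_ofReal_coe]
  calc _ ≤ f₁ x / (f₁ x + f₂ x) * (f₁ x + f₂ x) := by gcongr; exact h x
    _ ≤ f₁ x := by
      rcases eq_or_ne (f₁ x + f₂ x) 0 with h0 | h0
      · simp [h0]
      · rw [div_mul_cancel₀ _ h0]

theorem dominatedPart_add_dominatedPart (g : C₀(L, 𝕜)) (f₁ f₂ : C_c(L, ℝ≥0))
    (h : ∀ x, ‖g x‖₊ ≤ f₁ x + f₂ x) (h' : ∀ x, ‖g x‖₊ ≤ f₂ x + f₁ x) :
    dominatedPart g f₁ f₂ h + dominatedPart g f₂ f₁ h' = g := by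
  ext x
  change (((f₁ x / (f₁ x + f₂ x) : ℝ≥0) : ℝ) : 𝕜) * g x +
    (((f₂ x / (f₂ x + f₁ x) : ℝ≥0) : ℝ) : 𝕜) * g x = g x
  by_cases hx : f₁ x + f₂ x = 0
  · have hgx : g x = 0 := by simpa [hx] using h x
    simp [hgx]
  · rw [add_comm (f₂ x), ← add_mul, ← RCLike.ofReal_add, ← NNReal.coe_add, ← add_div, div_self hx]
    simp

/-- The value at `f ≥ 0` of the total variation of a functional `F` on `C₀(L)`: the supremum of
`‖F g‖` over `‖g‖ ≤ f`. -/
noncomputable def totalVariationAux (F : C₀(L, 𝕜) →L[𝕜] 𝕜) (f : C_c(L, ℝ≥0)) : ℝ≥0 :=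
  ⨆ g : {g : C₀(L, 𝕜) // ∀ x, ‖g x‖₊ ≤ f x}, ‖F g‖₊

theorem exists_bound_of_compactlySupported (f : C_c(L, ℝ≥0)) : ∃ C : ℝ≥0, ∀ x, f x ≤ C := by
  have hc : Continuous fun x => (f x : ℝ) := NNReal.continuous_coe.comp (map_continuous f)
  obtain ⟨C, hC⟩ := hc.bounded_above_of_compact_support
    (f.hasCompactSupport.comp_left NNReal.coe_zero)
  refine ⟨C.toNNReal, fun x => NNReal.le_toNNReal_of_coe_le ?_⟩
  have := hC x
  rwa [Real.norm_of_nonneg (NNReal.coe_nonneg _)] at this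

theorem nnnorm_apply_le_of_dominated (F : C₀(L, 𝕜) →L[𝕜] 𝕜) {g : C₀(L, 𝕜)} {C : ℝ≥0}
    (hg : ∀ x, ‖g x‖₊ ≤ C) : ‖F g‖₊ ≤ ‖F‖₊ * C :=
  have h : ‖g‖₊ ≤ C :=
    ZeroAtInftyContinuousMap.norm_le_of_forall C.coe_nonneg fun x => by exact_mod_cast hg x
  (F.le_opNNNorm g).trans (by gcongr)

theorem bddAbove_totalVariationAux (F : C₀(L, 𝕜) →L[𝕜] 𝕜) (f : C_c(L, ℝ≥0)) :
    BddAbove (Set.range fun g : {g : C₀(L, 𝕜) // ∀ x, ‖g x‖₊ ≤ f x} => ‖F g‖₊) := by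
  obtain ⟨C, hC⟩ := exists_bound_of_compactlySupported f
  refine ⟨‖F‖₊ * C, ?_⟩
  rintro _ ⟨g, rfl⟩
  exact nnnorm_apply_le_of_dominated F fun x => (g.2 x).trans (hC x)

theorem le_totalVariationAux (F : C₀(L, 𝕜) →L[𝕜] 𝕜) {f : C_c(L, ℝ≥0)} {g : C₀(L, 𝕜)}
    (hg : ∀ x, ‖g x‖₊ ≤ f x) : ‖F g‖₊ ≤ totalVariationAux F f :=
  le_ciSup (bddAbove_totalVariationAux F f) ⟨g, hg⟩

theorem totalVariationAux_le (F : C₀(L, 𝕜) →L[𝕜] 𝕜) {f : C_c(L, ℝ≥0)} {r : ℝ≥0}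
    (h : ∀ g : C₀(L, 𝕜), (∀ x, ‖g x‖₊ ≤ f x) → ‖F g‖₊ ≤ r) : totalVariationAux F f ≤ r :=
  have : Nonempty {g : C₀(L, 𝕜) // ∀ x, ‖g x‖₊ ≤ f x} := ⟨⟨0, fun x => by simp⟩⟩
  ciSup_le fun g => h g.1 g.2

/-- Rotating the value of a functional onto the positive half-line. -/
theorem exists_phase (z : 𝕜) : ∃ c : 𝕜, ‖c‖ = 1 ∧ c * z = (‖z‖ : 𝕜) := by
  by_cases hz : z = 0
  · exact ⟨1, by simp, by simp [hz]⟩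
  · have h : (‖z‖ : 𝕜) ≠ 0 := by simpa using hz
    refine ⟨(‖z‖ : 𝕜) / z, ?_, div_mul_cancel₀ _ hz⟩
    rw [norm_div, RCLike.norm_ofReal, abs_norm, div_self (norm_ne_zero_iff.2 hz)]

theorem totalVariationAux_add (F : C₀(L, 𝕜) →L[𝕜] 𝕜) (f₁ f₂ : C_c(L, ℝ≥0)) :
    totalVariationAux F (f₁ + f₂) = totalVariationAux F f₁ + totalVariationAux F f₂ := by
  apply le_antisymm
  · refine totalVariationAux_le F fun g hg => ?_
    have h : ∀ x, ‖g x‖₊ ≤ f₁ x + f₂ x := hg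
    have h' : ∀ x, ‖g x‖₊ ≤ f₂ x + f₁ x := fun x => by rw [add_comm]; exact hg x
    rw [← dominatedPart_add_dominatedPart g f₁ f₂ h h', map_add]
    exact (nnnorm_add_le _ _).trans (add_le_add
      (le_totalVariationAux F (nnnorm_dominatedPart_le g f₁ f₂ h))
      (le_totalVariationAux F (nnnorm_dominatedPart_le g f₂ f₁ h')))
  · have key : ∀ g₁ g₂ : C₀(L, 𝕜), (∀ x, ‖g₁ x‖₊ ≤ f₁ x) → (∀ x, ‖g₂ x‖₊ ≤ f₂ x) →
        ‖F g₁‖₊ + ‖F g₂‖₊ ≤ totalVariationAux F (f₁ + f₂) := by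
      intro g₁ g₂ h₁ h₂
      obtain ⟨c₁, hc₁, hF₁⟩ := exists_phase (F g₁)
      obtain ⟨c₂, hc₂, hF₂⟩ := exists_phase (F g₂)
      have h : ‖F (c₁ • g₁ + c₂ • g₂)‖₊ = ‖F g₁‖₊ + ‖F g₂‖₊ := by
        rw [map_add, map_smul, map_smul, smul_eq_mul, smul_eq_mul, hF₁, hF₂, ← RCLike.ofReal_add]
        ext
        rw [coe_nnnorm, RCLike.norm_ofReal, abs_of_nonneg (by positivity)]
        simp
      rw [← h]
      refine le_totalVariationAux F fun x => (nnnorm_add_le _ _).trans (add_le_add ?_ ?_)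
      · change ‖c₁ * g₁ x‖₊ ≤ _
        rw [nnnorm_mul, show ‖c₁‖₊ = 1 from NNReal.eq hc₁, one_mul]
        exact h₁ x
      · change ‖c₂ * g₂ x‖₊ ≤ _
        rw [nnnorm_mul, show ‖c₂‖₊ = 1 from NNReal.eq hc₂, one_mul]
        exact h₂ x
    have h1 : ∀ g₁ : C₀(L, 𝕜), (∀ x, ‖g₁ x‖₊ ≤ f₁ x) →
        totalVariationAux F f₂ ≤ totalVariationAux F (f₁ + f₂) - ‖F g₁‖₊ := fun g₁ hg₁ =>
      totalVariationAux_le F fun g₂ hg₂ => le_tsub_of_add_le_left (key g₁ g₂ hg₁ hg₂)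
    have h0 : totalVariationAux F f₂ ≤ totalVariationAux F (f₁ + f₂) := by
      simpa using h1 0 (by simp)
    have h2 : totalVariationAux F f₁ ≤ totalVariationAux F (f₁ + f₂) - totalVariationAux F f₂ :=
      totalVariationAux_le F fun g₁ hg₁ => by
        have hle : ‖F g₁‖₊ ≤ totalVariationAux F (f₁ + f₂) := by
          simpa using key g₁ 0 hg₁ (by simp)
        have := add_le_of_le_tsub_right_of_le hle (h1 g₁ hg₁)
        exact le_tsub_of_add_le_left this
    exact add_le_of_le_tsub_right_of_le h0 h2

theorem totalVariationAux_smul_le (F : C₀(L, 𝕜) →L[𝕜] 𝕜) (c : ℝ≥0) (f : C_c(L, ℝ≥0)) :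
    c * totalVariationAux F f ≤ totalVariationAux F (c • f) := by
  rw [totalVariationAux, NNReal.mul_iSup]
  have : Nonempty {g : C₀(L, 𝕜) // ∀ x, ‖g x‖₊ ≤ f x} := ⟨⟨0, fun x => by simp⟩⟩
  refine ciSup_le fun g => ?_
  have hc : ‖((c : ℝ) : 𝕜)‖₊ = c := nnnorm_ofReal_coe c
  have h : c * ‖F g‖₊ = ‖F (((c : ℝ) : 𝕜) • g.1)‖₊ := by
    rw [map_smul, nnnorm_smul, hc]
  rw [h]
  refine le_totalVariationAux F fun x => ?_
  change ‖((c : ℝ) : 𝕜) * g.1 x‖₊ ≤ c * f x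
  rw [nnnorm_mul, hc]
  exact mul_le_mul_right (g.2 x) c

/-- The total variation of a functional `F` on `C₀(L)`, as a positive linear functional. -/
noncomputable def totalVariation (F : C₀(L, 𝕜) →L[𝕜] 𝕜) : C_c(L, ℝ≥0) →ₗ[ℝ≥0] ℝ≥0 where
  toFun := totalVariationAux F
  map_add' := totalVariationAux_add F
  map_smul' c f := by
    rcases eq_or_ne c 0 with rfl | hc
    · simp only [zero_smul, RingHom.id_apply]
      refine le_antisymm (totalVariationAux_le F fun g hg => ?_) zero_le
      have : g = 0 := by ext x; simpa using hg x
      simp [this]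
    · refine le_antisymm ?_ (totalVariationAux_smul_le F c f)
      have h := totalVariationAux_smul_le F c⁻¹ (c • f)
      rw [inv_smul_smul₀ hc] at h
      calc totalVariationAux F (c • f) = c * (c⁻¹ * totalVariationAux F (c • f)) := by
            rw [mul_inv_cancel_left₀ hc]
        _ ≤ c * totalVariationAux F f := mul_le_mul_right h c

theorem nnnorm_apply_le_totalVariation (F : C₀(L, 𝕜) →L[𝕜] 𝕜) {f : C_c(L, ℝ≥0)} {g : C₀(L, 𝕜)}
    (hg : ∀ x, ‖g x‖₊ ≤ f x) : ‖F g‖₊ ≤ totalVariation F f :=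
  le_totalVariationAux F hg

theorem totalVariation_le (F : C₀(L, 𝕜) →L[𝕜] 𝕜) {f : C_c(L, ℝ≥0)} (hf : ∀ x, f x ≤ 1) :
    totalVariation F f ≤ ‖F‖₊ :=
  totalVariationAux_le F fun g hg => by
    simpa using nnnorm_apply_le_of_dominated F fun x => (hg x).trans (hf x)

/-! ### Dominating measures and approximate densities -/

theorem isCompact_setOf_le_norm (f : C₀(L, 𝕜)) {δ : ℝ} (hδ : 0 < δ) :
    IsCompact {x | δ ≤ ‖f x‖} := by
  have h1 : ∀ᶠ x in Filter.cocompact L, ‖f x‖ < δ := by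
    have := (zero_at_infty f).norm
    rw [norm_zero] at this
    exact this.eventually_lt_const hδ
  obtain ⟨K, hK, hKs⟩ := Filter.mem_cocompact'.1 h1
  exact hK.of_isClosed_subset (isClosed_le continuous_const (map_continuous f).norm)
    fun x hx => hKs fun hlt => not_lt.2 (show δ ≤ ‖f x‖ from hx) hlt

/-- Soft thresholding: every element of `C₀(L)` is a uniform limit of compactly supported functions
that it dominates. -/
theorem exists_hasCompactSupport_norm_sub_le (g : C₀(L, 𝕜)) {δ : ℝ} (hδ : 0 < δ) :
    ∃ g' : C₀(L, 𝕜), HasCompactSupport g' ∧ (∀ x, ‖g' x‖ ≤ ‖g x‖) ∧ ‖g - g'‖ ≤ δ := by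
  have hpos : ∀ x, 0 < max ‖g x‖ δ := fun x => lt_max_of_lt_right hδ
  have hcont : Continuous fun x => ((1 - δ / max ‖g x‖ δ : ℝ) : 𝕜) * g x := by
    refine (RCLike.continuous_ofReal.comp (continuous_const.sub (continuous_const.div
      ((map_continuous g).norm.max continuous_const) fun x => (hpos x).ne'))).mul (map_continuous g)
  have h01 : ∀ x, 0 ≤ 1 - δ / max ‖g x‖ δ ∧ 1 - δ / max ‖g x‖ δ ≤ 1 := fun x => by
    have h1 : δ / max ‖g x‖ δ ≤ 1 := (div_le_one (hpos x)).2 (le_max_right _ _)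
    have h2 : 0 ≤ δ / max ‖g x‖ δ := by positivity
    constructor <;> linarith
  have hsupp : HasCompactSupport fun x => ((1 - δ / max ‖g x‖ δ : ℝ) : 𝕜) * g x := by
    have hcpt := isCompact_setOf_le_norm g hδ
    refine hcpt.of_isClosed_subset (isClosed_tsupport _) (closure_minimal (fun x hx => ?_)
      (isClosed_le continuous_const (map_continuous g).norm))
    by_contra hlt
    apply hx
    simp only [Set.mem_ofPred_eq, not_le] at hlt
    simp [max_eq_right hlt.le, hδ.ne']
  refine ⟨⟨⟨_, hcont⟩, ?_⟩, hsupp, fun x => ?_, ?_⟩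
  · exact hsupp.is_zero_at_infty
  · change ‖((1 - δ / max ‖g x‖ δ : ℝ) : 𝕜) * g x‖ ≤ ‖g x‖
    rw [norm_mul, RCLike.norm_ofReal, abs_of_nonneg (h01 x).1]
    exact mul_le_of_le_one_left (norm_nonneg _) (h01 x).2
  · refine ZeroAtInftyContinuousMap.norm_le_of_forall hδ.le fun x => ?_
    change ‖g x - ((1 - δ / max ‖g x‖ δ : ℝ) : 𝕜) * g x‖ ≤ δ
    have h1 : g x - ((1 - δ / max ‖g x‖ δ : ℝ) : 𝕜) * g x = ((δ / max ‖g x‖ δ : ℝ) : 𝕜) * g x := by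
      push_cast; ring
    rw [h1, norm_mul, RCLike.norm_ofReal, abs_of_nonneg (by positivity), div_mul_eq_mul_div]
    exact div_le_of_le_mul₀ (hpos x).le hδ.le (mul_le_mul_of_nonneg_left (le_max_left _ _) hδ.le)

theorem ZeroAtInftyContinuousMap.integrable [MeasurableSpace L] [BorelSpace L] {μ : Measure L}
    [IsFiniteMeasure μ] (g : C₀(L, 𝕜)) : Integrable g μ :=
  Integrable.of_bound (map_continuous g).aestronglyMeasurable ‖g‖
    (Filter.Eventually.of_forall g.norm_apply_le)

/-- Finitely many functionals on `C₀(L)` are dominated by one finite regular measure: the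
Riesz-Markov-Kakutani measure of the sum of their total variations. -/
theorem exists_measure_dominating [T2Space L] [LocallyCompactSpace L] [MeasurableSpace L]
    [BorelSpace L] (s : Finset (C₀(L, 𝕜) →L[𝕜] 𝕜)) :
    ∃ μ : Measure L, μ.Regular ∧ IsFiniteMeasure μ ∧
      ∀ F ∈ s, ∀ g : C₀(L, 𝕜), ‖F g‖ ≤ ∫ x, ‖g x‖ ∂μ := by
  set Λ : C_c(L, ℝ≥0) →ₗ[ℝ≥0] ℝ≥0 := ∑ F ∈ s, totalVariation F with hΛ
  have hΛs : ∀ f, Λ f = ∑ F ∈ s, totalVariation F f := fun f => by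
    rw [hΛ, LinearMap.sum_apply]
  have hfin : IsFiniteMeasure (NNRealRMK.rieszMeasure Λ) := by
    constructor
    refine lt_of_le_of_lt ?_ (ENNReal.coe_lt_top (r := ∑ F ∈ s, ‖F‖₊))
    rw [isOpen_univ.measure_eq_iSup_isCompact]
    refine iSup₂_le fun K _ => iSup_le fun hK => ?_
    obtain ⟨f, hf1, -, hfc, hf01⟩ :=
      exists_continuous_one_zero_of_isCompact hK isClosed_empty (Set.disjoint_empty K)
    let f' : C_c(L, ℝ≥0) := CompactlySupportedContinuousMap.nnrealPart ⟨f, hfc⟩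
    have hf' : ∀ x, f' x ≤ 1 := fun x => by
      simpa [f', Real.toNNReal_le_one] using (hf01 x).2
    calc NNRealRMK.rieszMeasure Λ K
        = ∫⁻ x in K, 1 ∂(NNRealRMK.rieszMeasure Λ) := by simp
      _ ≤ ∫⁻ x in K, f' x ∂(NNRealRMK.rieszMeasure Λ) := by
          refine setLIntegral_mono' hK.measurableSet fun x hx => ?_
          have : f' x = 1 := by
            change (f x).toNNReal = 1
            rw [hf1 hx]; simp
          simp [this]
      _ ≤ ∫⁻ x, f' x ∂(NNRealRMK.rieszMeasure Λ) := setLIntegral_le_lintegral _ _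
      _ = Λ f' := NNRealRMK.lintegral_rieszMeasure Λ f'
      _ ≤ _ := by
          rw [ENNReal.coe_le_coe, hΛs]
          exact Finset.sum_le_sum fun F _ => totalVariation_le F hf'
  refine ⟨NNRealRMK.rieszMeasure Λ, inferInstance, hfin, fun F hF g => ?_⟩
  refine le_of_forall_pos_le_add fun δ hδ => ?_
  obtain ⟨g', hg'c, hg'le, hg'⟩ :=
    exists_hasCompactSupport_norm_sub_le g (δ := δ / (‖F‖ + 1)) (by positivity)
  let f : C_c(L, ℝ≥0) := ⟨⟨fun x => ‖g' x‖₊, (map_continuous g').nnnorm⟩,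
    hg'c.comp_left nnnorm_zero⟩
  have h1 : ‖F g'‖ ≤ ∫ x, ‖g x‖ ∂(NNRealRMK.rieszMeasure Λ) := by
    calc ‖F g'‖ ≤ totalVariation F f := by
          exact_mod_cast nnnorm_apply_le_totalVariation F (f := f) fun x => le_rfl
      _ ≤ Λ f := by
          rw [hΛs, NNReal.coe_le_coe]
          exact Finset.single_le_sum (f := fun F => totalVariation F f) (fun _ _ => zero_le) hF
      _ = ∫ x, ‖g' x‖ ∂(NNRealRMK.rieszMeasure Λ) :=
          (NNRealRMK.integral_rieszMeasure Λ f).symm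
      _ ≤ _ := integral_mono g'.integrable.norm g.integrable.norm hg'le
  have h2 : ‖F (g - g')‖ ≤ δ := by
    refine (F.le_opNorm_of_le hg').trans ?_
    rw [mul_div_assoc', div_le_iff₀ (by positivity)]
    nlinarith [norm_nonneg F]
  rw [map_sub] at h2
  linarith [norm_le_norm_add_norm_sub' (F g) (F g')]

/-- A functional on `C₀(L)` dominated by a finite measure `μ` has, approximately, a density in
`C₀(L)` with respect to `μ`. The density is the conjugate of an approximate minimizer `v` of the
quadratic functional `∫ ‖v‖² ∂μ - 2 * re (F v)`, which is bounded below since `F` is dominated by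
`μ`; the first variation of the functional must almost vanish at `v`. -/
theorem exists_approx_density [MeasurableSpace L] [BorelSpace L] {μ : Measure L}
    [IsFiniteMeasure μ] {F : C₀(L, 𝕜) →L[𝕜] 𝕜} (hF : ∀ g : C₀(L, 𝕜), ‖F g‖ ≤ ∫ x, ‖g x‖ ∂μ)
    {δ : ℝ} (hδ : 0 < δ) :
    ∃ h : C₀(L, 𝕜), ∀ g : C₀(L, 𝕜), ‖g‖ ≤ 1 → ‖F g - ∫ x, h x * g x ∂μ‖ ≤ δ := by
  let J : C₀(L, 𝕜) → ℝ := fun v => ∫ x, ‖v x‖ ^ 2 ∂μ - 2 * RCLike.re (F v)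
  have hsq : ∀ v : C₀(L, 𝕜), Integrable (fun x => ‖v x‖ ^ 2) μ := fun v => by
    have := (star v * v).integrable (μ := μ) |>.norm
    refine this.congr (Filter.Eventually.of_forall fun x => ?_)
    simp [sq]
  set R := μ.real Set.univ with hR
  have hR0 : 0 ≤ R := measureReal_nonneg
  have hJ : BddBelow (Set.range J) := by
    refine ⟨-R, ?_⟩
    rintro _ ⟨v, rfl⟩
    have h1 : ∫ x, (2 * ‖v x‖ - 1) ∂μ ≤ ∫ x, ‖v x‖ ^ 2 ∂μ :=
      integral_mono ((v.integrable.norm.const_mul 2).sub (integrable_const 1)) (hsq v) fun x => by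
        simp only; nlinarith [sq_nonneg (‖v x‖ - 1)]
    rw [integral_sub (v.integrable.norm.const_mul 2) (integrable_const 1), integral_const_mul,
      integral_const, smul_eq_mul, mul_one] at h1
    have h2 := (RCLike.re_le_norm (F v)).trans (hF v)
    simp only [J]
    linarith
  -- The step `s` in the direction of `g`, and the accuracy `δ * s` of the minimizer, balance the
  -- first-order term against the second-order term `s ^ 2 * R`.
  set s := δ / (R + 1) with hs
  have hs0 : 0 < s := by positivity
  have hsR : s * R ≤ δ := by
    rw [hs, div_mul_eq_mul_div, div_le_iff₀ (by positivity)]; nlinarith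
  obtain ⟨_, ⟨v, rfl⟩, hv⟩ := exists_lt_of_csInf_lt (Set.range_nonempty J)
    (lt_add_of_pos_right (sInf (Set.range J)) (mul_pos hδ hs0))
  refine ⟨star v, fun g hg => ?_⟩
  set D := F g - ∫ x, (star v) x * g x ∂μ with hD
  obtain ⟨c, hc, hcD⟩ := exists_phase D
  have hJmin : J v - δ * s ≤ J (v + ((s : 𝕜) * c) • g) := by
    have := csInf_le hJ ⟨v + ((s : 𝕜) * c) • g, rfl⟩
    linarith
  have hint : Integrable (fun x => (star v) x * g x) μ := (star v * g).integrable
  have hexp : ∫ x, ‖(v + ((s : 𝕜) * c) • g) x‖ ^ 2 ∂μ = ∫ x, ‖v x‖ ^ 2 ∂μ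
      + 2 * RCLike.re ((s : 𝕜) * c * ∫ x, (star v) x * g x ∂μ) + s ^ 2 * ∫ x, ‖g x‖ ^ 2 ∂μ := by
    have h1 : ∀ x, ‖(v + ((s : 𝕜) * c) • g) x‖ ^ 2 = ‖v x‖ ^ 2
        + 2 * RCLike.re ((s : 𝕜) * c * ((star v) x * g x)) + s ^ 2 * ‖g x‖ ^ 2 := fun x => by
      have h2 := @norm_add_sq 𝕜 𝕜 _ _ _ (v x) ((s : 𝕜) * c * g x)
      have h3 : ‖(s : 𝕜) * c * g x‖ = s * ‖g x‖ := by
        rw [norm_mul, norm_mul, hc, RCLike.norm_ofReal, abs_of_pos hs0, mul_one]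
      rw [h3] at h2
      change ‖v x + (s : 𝕜) * c * g x‖ ^ 2 = _
      rw [h2, RCLike.inner_apply, ZeroAtInftyContinuousMap.star_apply, RCLike.star_def, mul_pow]
      ring_nf
    simp_rw [h1]
    have hi : Integrable (fun x => RCLike.re ((s : 𝕜) * c * ((star v) x * g x))) μ :=
      (hint.const_mul _).re
    have hi' : Integrable (fun x => ‖v x‖ ^ 2
        + 2 * RCLike.re ((s : 𝕜) * c * ((star v) x * g x))) μ := (hsq v).add (hi.const_mul 2)
    rw [integral_add hi' ((hsq g).const_mul _),
      integral_add (hsq v) (hi.const_mul 2), integral_const_mul, integral_const_mul,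
      integral_re (hint.const_mul _), integral_const_mul]
  have hF' : RCLike.re (F (v + ((s : 𝕜) * c) • g)) = RCLike.re (F v)
      + RCLike.re ((s : 𝕜) * c * F g) := by
    rw [map_add, map_smul, smul_eq_mul, map_add]
  have hcD' : RCLike.re ((s : 𝕜) * c * F g) - RCLike.re ((s : 𝕜) * c * ∫ x, (star v) x * g x ∂μ)
      = s * ‖D‖ := by
    rw [← map_sub, ← mul_sub, ← hD, mul_assoc, hcD, ← RCLike.ofReal_mul, RCLike.ofReal_re]
  have hgR : ∫ x, ‖g x‖ ^ 2 ∂μ ≤ R := by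
    have : ∫ x, ‖g x‖ ^ 2 ∂μ ≤ ∫ _, (1 : ℝ) ∂μ :=
      integral_mono (hsq g) (integrable_const 1) fun x =>
        pow_le_one₀ (norm_nonneg _) ((g.norm_apply_le x).trans hg)
    simpa using this
  simp only [J] at hJmin
  rw [hexp, hF'] at hJmin
  have h1 : s * (2 * ‖D‖) ≤ s * (δ + s * R) := by
    nlinarith [mul_le_mul_of_nonneg_left hgR (sq_nonneg s)]
  have h2 := le_of_mul_le_mul_left h1 hs0
  linarith

end

/-! ### Partitions of unity with plateaus -/

/-- A finite partition of unity on a set `C`, by compactly supported functions, in which every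
function `φ i` has a plateau: a nonempty compact set `K i` on which `φ i = 1`. -/
structure PlateauPartition {L : Type*} [TopologicalSpace L] (C : Set L) (ι : Type*)
    [Fintype ι] where
  /-- The plateaus. -/
  K : ι → Set L
  /-- The partition functions. -/
  φ : ι → C(L, ℝ)
  isCompact_K : ∀ i, IsCompact (K i)
  nonempty_K : ∀ i, (K i).Nonempty
  hasCompactSupport : ∀ i, HasCompactSupport (φ i)
  nonneg : ∀ i x, 0 ≤ φ i x
  sum_le_one : ∀ x, ∑ i, φ i x ≤ 1
  sum_eq_one : ∀ x ∈ C, ∑ i, φ i x = 1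
  eq_one : ∀ i, ∀ x ∈ K i, φ i x = 1

namespace PlateauPartition
variable {𝕜 : Type*} [RCLike 𝕜] {L : Type*} [TopologicalSpace L] {C : Set L} {ι : Type*}
  [Fintype ι]

theorem eq_zero (P : PlateauPartition C ι) {i j : ι} (hij : j ≠ i) {x : L} (hx : x ∈ P.K i) :
    P.φ j x = 0 := by
  classical
  have h := P.sum_le_one x
  rw [← Finset.add_sum_erase _ _ (Finset.mem_univ i), P.eq_one i x hx] at h
  have h1 : P.φ j x ≤ ∑ k ∈ Finset.univ.erase i, P.φ k x :=
    Finset.single_le_sum (f := fun k => P.φ k x) (fun k _ => P.nonneg k x) (by simp [hij])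
  linarith [P.nonneg j x]

theorem disjoint_K (P : PlateauPartition C ι) : Pairwise (Function.onFun Disjoint P.K) := by
  intro i j hij
  refine Set.disjoint_left.2 fun x hi hj => ?_
  have := P.eq_zero hij hj
  rw [P.eq_one i x hi] at this
  exact one_ne_zero this

/-- A compact set carries partitions with plateaus, subordinate to any open cover, whose plateaus
miss only a small portion of `C`. The plateaus are compact subsets of the nonempty members of the
disjoint refinement of a finite subcover; discarding the empty members does not affect the cover. -/
theorem exists_subordinate [T2Space L] [LocallyCompactSpace L] [MeasurableSpace L] [BorelSpace L]
    (μ : Measure L) [IsFiniteMeasure μ] [μ.Regular] (hC : IsCompact C) {U : L → Set L}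
    (hUo : ∀ t, IsOpen (U t)) (hU : ∀ t, t ∈ U t) {κ : ℝ} (hκ : 0 < κ) :
    ∃ (ι : Type) (_ : Fintype ι) (P : PlateauPartition C ι),
      μ.real (C \ ⋃ i, P.K i) ≤ κ ∧ ∀ i, ∃ t, ∀ x, P.φ i x ≠ 0 → x ∈ U t := by
  classical
  obtain ⟨t, -, ht⟩ := hC.elim_nhds_subcover U fun x _ => (hUo x).mem_nhds (hU x)
  let V : Fin t.card → Set L := fun i => U (t.equivFin.symm i)
  have hVo : ∀ i, IsOpen (V i) := fun i => hUo _
  have hCV : C ⊆ ⋃ i, V i := fun x hx => by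
    obtain ⟨y, hy, hxy⟩ := Set.mem_iUnion₂.1 (ht hx)
    exact Set.mem_iUnion.2 ⟨t.equivFin ⟨y, hy⟩, by simpa [V] using hxy⟩
  let B : Fin t.card → Set L := fun i => C ∩ disjointed V i
  have hBm : ∀ i, MeasurableSet (B i) := fun i =>
    hC.measurableSet.inter <| by
      rw [disjointed_apply, Finset.sup_set_eq_biUnion]
      exact (hVo i).measurableSet.diff
        (Finset.measurableSet_biUnion _ fun j _ => (hVo j).measurableSet)
  have hCB : C ⊆ ⋃ i, B i := fun x hx => by
    have := hCV hx
    rw [← iUnion_disjointed] at this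
    obtain ⟨i, hi⟩ := Set.mem_iUnion.1 this
    exact Set.mem_iUnion.2 ⟨i, hx, hi⟩
  have hBd : ∀ i j x, x ∈ B i → x ∈ B j → i = j := fun i j x hi hj => by
    by_contra hij
    exact Set.disjoint_left.1 (disjoint_disjointed V hij) hi.2 hj.2
  set κ' : ℝ := κ / (t.card + 1) with hκ'
  have hκ'0 : 0 < κ' := by positivity
  have hK : ∀ i : {i // (B i).Nonempty}, ∃ K : Set L, K ⊆ B i ∧ IsCompact K ∧ K.Nonempty ∧
      μ.real (B i \ K) ≤ κ' := by
    rintro ⟨i, p, hp⟩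
    obtain ⟨K, hKB, hKc, hK⟩ := (hBm i).exists_isCompact_sdiff_lt (μ := μ) (measure_ne_top μ _)
      (ENNReal.ofReal_pos.2 hκ'0).ne'
    refine ⟨insert p K, Set.insert_subset hp hKB, hKc.insert p, Set.insert_nonempty _ _, ?_⟩
    refine ENNReal.toReal_le_of_le_ofReal hκ'0.le (le_trans (measure_mono ?_) hK.le)
    exact Set.sdiff_subset_sdiff_right (Set.subset_insert _ _)
  choose K hKB hKc hKn hKκ using hK
  -- Removing the other plateaus from `V i` forces the partition functions to be one on plateaus.
  let W : {i // (B i).Nonempty} → Set L := fun i => V i \ ⋃ j : {j // j ≠ i}, K j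
  have hWo : ∀ i, IsOpen (W i) := fun i =>
    (hVo i).sdiff (isClosed_iUnion_of_finite fun j => (hKc j).isClosed)
  have hCW : C ⊆ ⋃ i, W i := fun x hx => by
    obtain ⟨i, hi⟩ := Set.mem_iUnion.1 (hCB hx)
    refine Set.mem_iUnion.2 ⟨⟨i, x, hi⟩, disjointed_subset V i hi.2, fun hx' => ?_⟩
    obtain ⟨j, hj⟩ := Set.mem_iUnion.1 hx'
    exact j.2 (Subtype.ext (hBd _ _ x (hKB _ hj) hi))
  obtain ⟨f, hfW, hfc⟩ := PartitionOfUnity.exists_isSubordinate_of_locallyFinite_t2space hC W hWo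
    (locallyFinite_of_finite _) hCW
  have hsum : ∀ x, ∑ i, f i x = ∑ᶠ i, f i x := fun x => (finsum_eq_sum_of_fintype _).symm
  have hfWx : ∀ i x, f i x ≠ 0 → x ∈ W i := fun i x hx => hfW i (subset_tsupport _ hx)
  have hKC : ∀ i, K i ⊆ C := fun i x hx => (hKB i hx).1
  refine ⟨{i // (B i).Nonempty}, inferInstance,
    { K := K
      φ := f
      isCompact_K := hKc
      nonempty_K := hKn
      hasCompactSupport := hfc
      nonneg := fun i x => f.nonneg i x
      sum_le_one := fun x => (hsum x).trans_le (f.sum_le_one x)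
      sum_eq_one := fun x hx => (hsum x).trans (f.sum_eq_one hx)
      eq_one := fun i x hx => ?_ }, ?_, fun i => ⟨_, fun x hx => (hfWx i x hx).1⟩⟩
  · rw [← f.sum_eq_one (hKC i hx), ← hsum, Finset.sum_eq_single_of_mem i (Finset.mem_univ i)]
    intro j _ hji
    by_contra hne
    exact (hfWx j x hne).2 (Set.mem_iUnion.2 ⟨⟨i, hji.symm⟩, hx⟩)
  · change μ.real (C \ ⋃ i, K i) ≤ κ
    have hsub : C \ ⋃ i, K i ⊆ ⋃ i : {i // (B i).Nonempty}, B i \ K i := by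
      rintro x ⟨hx, hxK⟩
      obtain ⟨i, hi⟩ := Set.mem_iUnion.1 (hCB hx)
      exact Set.mem_iUnion.2 ⟨⟨i, x, hi⟩, hi, fun h => hxK (Set.mem_iUnion.2 ⟨_, h⟩)⟩
    calc μ.real (C \ ⋃ i, K i) ≤ μ.real (⋃ i : {i // (B i).Nonempty}, B i \ K i) :=
          measureReal_mono hsub
      _ ≤ ∑ i : {i // (B i).Nonempty}, μ.real (B i \ K i) := measureReal_iUnion_fintype_le _
      _ ≤ ∑ _i : {i // (B i).Nonempty}, κ' := Finset.sum_le_sum fun i _ => hKκ i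
      _ = Fintype.card {i // (B i).Nonempty} * κ' := by simp
      _ ≤ t.card * κ' := by
          gcongr
          exact (Fintype.card_subtype_le _).trans_eq (Fintype.card_fin _)
      _ ≤ κ := by
          rw [hκ', mul_div_assoc', div_le_iff₀ (by positivity)]
          nlinarith

/-- The isometric embedding `u ↦ ∑ i, u i • φ i` of `ℓ_∞^ι` into `C₀(L)`. -/
noncomputable def synthesis (𝕜 : Type*) [RCLike 𝕜] (P : PlateauPartition C ι) :
    (ι → 𝕜) →ₗ[𝕜] C₀(L, 𝕜) where
  toFun u :=
    { toFun := fun x => ∑ i, (P.φ i x : 𝕜) * u i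
      continuous_toFun := continuous_finsetSum _ fun i _ =>
        (RCLike.continuous_ofReal.comp (map_continuous (P.φ i))).mul continuous_const
      zero_at_infty' := by
        rw [← Finset.sum_const_zero (s := Finset.univ (α := ι))]
        refine tendsto_finsetSum _ fun i _ => ?_
        exact (((P.hasCompactSupport i).comp_left (g := fun r : ℝ => (r : 𝕜))
          RCLike.ofReal_zero).mul_right (f' := fun _ => u i)).is_zero_at_infty }
  map_add' u v := by
    ext x
    change ∑ i, (P.φ i x : 𝕜) * (u i + v i) = ∑ i, (P.φ i x : 𝕜) * u i + ∑ i, (P.φ i x : 𝕜) * v i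
    simp only [mul_add, Finset.sum_add_distrib]
  map_smul' c u := by
    ext x
    change ∑ i, (P.φ i x : 𝕜) * (c * u i) = c * ∑ i, (P.φ i x : 𝕜) * u i
    rw [Finset.mul_sum]
    exact Finset.sum_congr rfl fun i _ => by ring

theorem synthesis_apply (P : PlateauPartition C ι) (u : ι → 𝕜) (x : L) :
    P.synthesis 𝕜 u x = ∑ i, (P.φ i x : 𝕜) * u i := rfl

theorem synthesis_apply_of_mem (P : PlateauPartition C ι) (u : ι → 𝕜) {i : ι} {x : L}
    (hx : x ∈ P.K i) : P.synthesis 𝕜 u x = u i := by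
  rw [synthesis_apply, Finset.sum_eq_single_of_mem i (Finset.mem_univ i), P.eq_one i x hx]
  · simp
  · intro j _ hj
    simp [P.eq_zero hj hx]

theorem norm_synthesis_le (P : PlateauPartition C ι) (u : ι → 𝕜) : ‖P.synthesis 𝕜 u‖ ≤ ‖u‖ := by
  refine ZeroAtInftyContinuousMap.norm_le_of_forall (norm_nonneg u) fun x => ?_
  rw [synthesis_apply]
  calc ‖∑ i, (P.φ i x : 𝕜) * u i‖ ≤ ∑ i, ‖(P.φ i x : 𝕜) * u i‖ := norm_sum_le _ _
    _ ≤ ∑ i, P.φ i x * ‖u‖ := Finset.sum_le_sum fun i _ => by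
        rw [norm_mul, RCLike.norm_ofReal, abs_of_nonneg (P.nonneg i x)]
        exact mul_le_mul_of_nonneg_left (norm_le_pi_norm u i) (P.nonneg i x)
    _ ≤ ‖u‖ := by
        rw [← Finset.sum_mul]
        exact mul_le_of_le_one_left (norm_nonneg u) (P.sum_le_one x)

/-- A combination `∑ i, u i • φ i` approximates `f` uniformly when `u i` approximates the values
of `f` on the support of `φ i`, and `f` is small outside `C`. -/
theorem norm_sub_synthesis_le (P : PlateauPartition C ι) {f : C₀(L, 𝕜)} {u : ι → 𝕜} {δ : ℝ}
    (hδ : 0 ≤ δ) (hu : ∀ i x, P.φ i x ≠ 0 → ‖f x - u i‖ ≤ δ) (hf : ∀ x ∉ C, ‖f x‖ ≤ δ) :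
    ‖f - P.synthesis 𝕜 u‖ ≤ δ := by
  refine ZeroAtInftyContinuousMap.norm_le_of_forall hδ fun x => ?_
  set σ := ∑ i, P.φ i x with hσ
  have hdec : (f - P.synthesis 𝕜 u) x
      = ((1 - σ : ℝ) : 𝕜) * f x + ∑ i, (P.φ i x : 𝕜) * (f x - u i) := by
    rw [ZeroAtInftyContinuousMap.sub_apply, synthesis_apply]
    simp only [mul_sub, Finset.sum_sub_distrib, ← Finset.sum_mul, hσ]
    push_cast
    ring
  have h1 : ‖((1 - σ : ℝ) : 𝕜) * f x‖ ≤ (1 - σ) * δ := by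
    rw [norm_mul, RCLike.norm_ofReal, abs_of_nonneg (by linarith [P.sum_le_one x])]
    by_cases hx : x ∈ C
    · rw [hσ, P.sum_eq_one x hx]; simp
    · exact mul_le_mul_of_nonneg_left (hf x hx) (by linarith [P.sum_le_one x])
  have h2 : ‖∑ i, (P.φ i x : 𝕜) * (f x - u i)‖ ≤ σ * δ := by
    rw [hσ, Finset.sum_mul]
    refine (norm_sum_le _ _).trans (Finset.sum_le_sum fun i _ => ?_)
    rw [norm_mul, RCLike.norm_ofReal, abs_of_nonneg (P.nonneg i x)]
    by_cases hi : P.φ i x = 0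
    · simp [hi]
    · exact mul_le_mul_of_nonneg_left (hu i x hi) (P.nonneg i x)
  rw [hdec]
  refine (norm_add_le _ _).trans ?_
  linarith

end PlateauPartition

/-! ### Means over plateaus -/

/-- The normalized restriction of a finite measure to a nonempty set, replaced by a point mass when
the set is null. -/
theorem exists_probabilityMeasure_restrict {L : Type*} [MeasurableSpace L] (μ : Measure L)
    [IsFiniteMeasure μ] {K : Set L} (hK : MeasurableSet K) (hne : K.Nonempty) :
    ∃ m : Measure L, IsProbabilityMeasure m ∧ (∀ᵐ x ∂m, x ∈ K) ∧ μ.restrict K = μ K • m := by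
  by_cases h0 : μ K = 0
  · obtain ⟨p, hp⟩ := hne
    refine ⟨Measure.dirac p, inferInstance, (ae_dirac_iff hK).2 hp, ?_⟩
    rw [Measure.restrict_eq_zero.2 h0, h0, zero_smul]
  · refine ⟨ProbabilityTheory.cond μ K, ProbabilityTheory.cond_isProbabilityMeasure h0, ?_, ?_⟩
    · rw [ProbabilityTheory.cond]
      exact Measure.ae_smul_measure (ae_restrict_mem hK) _
    · rw [ProbabilityTheory.cond, smul_smul, ENNReal.mul_inv_cancel h0 (measure_ne_top μ K),
        one_smul]

section
variable {𝕜 : Type*} [RCLike 𝕜] {L : Type*} [TopologicalSpace L] [MeasurableSpace L] [BorelSpace L]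

/-- The means of a function with respect to finitely many probability measures. -/
noncomputable def sampling (𝕜 : Type*) [RCLike 𝕜] {ι : Type*} [Fintype ι] (m : ι → Measure L)
    [∀ i, IsProbabilityMeasure (m i)] : C₀(L, 𝕜) →ₗ[𝕜] (ι → 𝕜) where
  toFun f i := ∫ x, f x ∂(m i)
  map_add' f g := funext fun _ => integral_add f.integrable g.integrable
  map_smul' c f := funext fun _ => integral_const_mul c f

theorem sampling_apply {ι : Type*} [Fintype ι] (m : ι → Measure L)
    [∀ i, IsProbabilityMeasure (m i)] (f : C₀(L, 𝕜)) (i : ι) :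
    sampling 𝕜 m f i = ∫ x, f x ∂(m i) := rfl

theorem norm_sampling_le {ι : Type*} [Fintype ι] (m : ι → Measure L)
    [∀ i, IsProbabilityMeasure (m i)] (f : C₀(L, 𝕜)) : ‖sampling 𝕜 m f‖ ≤ ‖f‖ := by
  refine (pi_norm_le_iff_of_nonneg (norm_nonneg f)).2 fun i => ?_
  rw [sampling_apply]
  simpa using norm_integral_le_of_norm_le_const (μ := m i)
    (Filter.Eventually.of_forall f.norm_apply_le)

theorem norm_sub_sampling_le {ι : Type*} [Fintype ι] (m : ι → Measure L)
    [∀ i, IsProbabilityMeasure (m i)] {f : C₀(L, 𝕜)} {i : ι} {c : 𝕜} {δ : ℝ}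
    (h : ∀ᵐ y ∂(m i), ‖c - f y‖ ≤ δ) : ‖c - sampling 𝕜 m f i‖ ≤ δ := by
  have h1 : c - sampling 𝕜 m f i = ∫ y, (c - f y) ∂(m i) := by
    rw [integral_sub (integrable_const c) f.integrable, sampling_apply]
    simp
  rw [h1]
  simpa using norm_integral_le_of_norm_le_const h

/-- If the means of `w` over the plateaus vanish and `h` is almost constant on each plateau and
small off `C`, then `∫ h * w` is small: up to a small error in `L¹(μ)`, `h` is a combination of the
indicator functions of the plateaus, which integrate `w` to zero. -/
theorem PlateauPartition.norm_integral_mul_le {C : Set L} {ι : Type*} [Fintype ι] [T2Space L]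
    (P : PlateauPartition C ι) (hC : IsCompact C) {μ : Measure L} [IsFiniteMeasure μ]
    {h w : C₀(L, 𝕜)} {δ M κ : ℝ} {c : ι → 𝕜}
    (hδ : 0 ≤ δ) (hM : ‖h‖ ≤ M) (hκ : μ.real (C \ ⋃ i, P.K i) ≤ κ)
    (hc : ∀ i, ∀ x ∈ P.K i, ‖h x - c i‖ ≤ δ)
    (hoff : ∀ x ∉ C, ‖h x‖ ≤ δ) (hw : ∀ i, ∫ x in P.K i, w x ∂μ = 0) :
    ‖∫ x, h x * w x ∂μ‖ ≤ (δ * μ.real Set.univ + M * κ) * ‖w‖ := by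
  have hKm : ∀ i, MeasurableSet (P.K i) := fun i => (P.isCompact_K i).measurableSet
  have hDm : MeasurableSet (C \ ⋃ i, P.K i) :=
    hC.measurableSet.diff (MeasurableSet.iUnion hKm)
  have hM0 : 0 ≤ M := (norm_nonneg h).trans hM
  let s : L → 𝕜 := fun x => ∑ i, (P.K i).indicator (fun _ => c i) x
  have hs0 : ∀ x, (∀ i, x ∉ P.K i) → s x = 0 := fun x hx =>
    Finset.sum_eq_zero fun i _ => Set.indicator_of_notMem (hx i) _
  have hsK : ∀ i, ∀ x ∈ P.K i, s x = c i := fun i x hx => by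
    simp only [s]
    rw [Finset.sum_eq_single_of_mem i (Finset.mem_univ i), Set.indicator_of_mem hx]
    intro j _ hj
    exact Set.indicator_of_notMem (fun hx' => Set.disjoint_left.1 (P.disjoint_K hj) hx' hx) _
  have hsw : ∀ x, s x * w x = ∑ i, (P.K i).indicator (fun x => c i * w x) x := fun x => by
    simp only [s]
    rw [Finset.sum_mul]
    refine Finset.sum_congr rfl fun i _ => ?_
    by_cases hx : x ∈ P.K i <;> simp [hx]
  have hswi : ∀ i, Integrable ((P.K i).indicator fun x => c i * w x) μ := fun i =>
    (w.integrable.const_mul (c i)).indicator (hKm i)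
  have hint_sw : Integrable (fun x => s x * w x) μ := by
    simp_rw [hsw]
    exact integrable_finsetSum _ fun i _ => hswi i
  have hzero : ∫ x, s x * w x ∂μ = 0 := by
    simp_rw [hsw]
    rw [integral_finsetSum _ fun i _ => hswi i]
    refine Finset.sum_eq_zero fun i _ => ?_
    rw [integral_indicator (hKm i), integral_const_mul, hw i, mul_zero]
  have hint : Integrable (fun x => h x * w x) μ := (h * w).integrable
  have hpt : ∀ x, ‖h x * w x - s x * w x‖
      ≤ (δ + (C \ ⋃ i, P.K i).indicator (fun _ => M) x) * ‖w‖ := fun x => by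
    rw [← sub_mul, norm_mul]
    have hwx := w.norm_apply_le x
    have hhs : ‖h x - s x‖ ≤ δ + (C \ ⋃ i, P.K i).indicator (fun _ => M) x := by
      by_cases hxK : ∃ i, x ∈ P.K i
      · obtain ⟨i, hi⟩ := hxK
        rw [hsK i x hi, Set.indicator_of_notMem fun hx => hx.2 (Set.mem_iUnion.2 ⟨i, hi⟩),
          add_zero]
        exact hc i x hi
      · rw [hs0 x (not_exists.1 hxK), sub_zero]
        by_cases hxC : x ∈ C
        · have hx : x ∈ C \ ⋃ i, P.K i := ⟨hxC, fun hx => hxK (Set.mem_iUnion.1 hx)⟩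
          rw [Set.indicator_of_mem hx]
          linarith [h.norm_apply_le x]
        · rw [Set.indicator_of_notMem fun hx => hxC hx.1, add_zero]
          exact hoff x hxC
    exact mul_le_mul hhs hwx (norm_nonneg _) ((norm_nonneg _).trans hhs)
  have hbi : Integrable (fun x => (C \ ⋃ i, P.K i).indicator (fun _ => M) x) μ :=
    (integrable_const M).indicator hDm
  calc ‖∫ x, h x * w x ∂μ‖ = ‖∫ x, (h x * w x - s x * w x) ∂μ‖ := by
        rw [integral_sub hint hint_sw, hzero, sub_zero]
    _ ≤ ∫ x, (δ + (C \ ⋃ i, P.K i).indicator (fun _ => M) x) * ‖w‖ ∂μ :=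
        norm_integral_le_of_norm_le (((integrable_const δ).add hbi).mul_const _)
          (Filter.Eventually.of_forall hpt)
    _ = (δ * μ.real Set.univ + M * μ.real (C \ ⋃ i, P.K i)) * ‖w‖ := by
        rw [integral_mul_const, integral_add (integrable_const δ) hbi, integral_indicator hDm]
        simp [mul_comm]
    _ ≤ _ := by gcongr

end

/-! ### Factorization through `ℓ_∞^ι` -/

section
variable {𝕜 : Type*} [RCLike 𝕜] {L : Type*} [TopologicalSpace L]

/-- Finitely many elements of `C₀(L)` are almost fixed, both uniformly and as densities with
respect to `μ`, by a contractive projection `J ∘ Q` of `C₀(L)` that factors through `ℓ_∞^ι` with `ι`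
finite: the operator `Q` takes means over the plateaus of a fine partition of unity, and `J` forms
the corresponding combinations of the partition functions. -/
theorem exists_pi_factorization [T2Space L] [LocallyCompactSpace L] [MeasurableSpace L]
    [BorelSpace L] (μ : Measure L) [IsFiniteMeasure μ] [μ.Regular] (s : Finset C₀(L, 𝕜)) {δ : ℝ}
    (hδ : 0 < δ) :
    ∃ (ι : Type) (_ : Fintype ι) (Q : C₀(L, 𝕜) →ₗ[𝕜] (ι → 𝕜)) (J : (ι → 𝕜) →ₗ[𝕜] C₀(L, 𝕜)),
      (∀ f, ‖Q f‖ ≤ ‖f‖) ∧ (∀ u, ‖J u‖ ≤ ‖u‖) ∧ (∀ u, Q (J u) = u) ∧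
      (∀ h ∈ s, ‖h - J (Q h)‖ ≤ δ) ∧
      ∀ h ∈ s, ∀ w, Q w = 0 → ‖∫ x, h x * w x ∂μ‖ ≤ δ * ‖w‖ := by
  classical
  set R := μ.real Set.univ with hR
  have hR0 : 0 ≤ R := measureReal_nonneg
  set M := ∑ h ∈ s, ‖h‖ with hMdef
  have hM0 : 0 ≤ M := Finset.sum_nonneg fun _ _ => norm_nonneg _
  have hM : ∀ h ∈ s, ‖h‖ ≤ M := fun h hh =>
    Finset.single_le_sum (f := fun h : C₀(L, 𝕜) => ‖h‖) (fun _ _ => norm_nonneg _) hh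
  -- The error in the last estimate is `(d * R + M * κ) * ‖w‖`.
  set d := δ / (2 * (R + 1)) with hd
  have hd0 : 0 < d := by positivity
  have hdR : d * R ≤ δ / 2 := by
    rw [hd, div_mul_eq_mul_div, div_le_div_iff₀ (by positivity) two_pos]; nlinarith
  have hdδ : d ≤ δ := div_le_self hδ.le (by linarith)
  set κ := δ / (2 * (M + 1)) with hκ
  have hκ0 : 0 < κ := by positivity
  have hMκ : M * κ ≤ δ / 2 := by
    rw [hκ, mul_div_assoc', div_le_div_iff₀ (by positivity) two_pos]; nlinarith
  have hC : IsCompact (⋃ h ∈ s, {x | d ≤ ‖h x‖}) :=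
    s.isCompact_biUnion fun h _ => isCompact_setOf_le_norm h hd0
  set C := ⋃ h ∈ s, {x | d ≤ ‖h x‖} with hCdef
  have hoff : ∀ h ∈ s, ∀ x ∉ C, ‖h x‖ ≤ d := fun h hh x hx => by
    by_contra hlt
    exact hx (Set.mem_iUnion₂.2 ⟨h, hh, (not_le.1 hlt).le⟩)
  let U : L → Set L := fun t => ⋂ h ∈ s, {x | ‖h x - h t‖ < d / 2}
  have hUo : ∀ t, IsOpen (U t) := fun t =>
    isOpen_biInter_finset fun h _ =>
      isOpen_lt ((map_continuous h).sub continuous_const).norm continuous_const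
  have hUmem : ∀ t, t ∈ U t := fun t => Set.mem_iInter₂.2 fun h _ => by simp [hd0]
  obtain ⟨ι, _, P, hPκ, hPU⟩ := PlateauPartition.exists_subordinate μ hC hUo hUmem hκ0
  have hosc : ∀ h ∈ s, ∀ i x y, P.φ i x ≠ 0 → y ∈ P.K i → ‖h x - h y‖ ≤ d := by
    intro h hh i x y hx hy
    obtain ⟨t, ht⟩ := hPU i
    have h1 : ‖h x - h t‖ < d / 2 := Set.mem_iInter₂.1 (ht x hx) h hh
    have h2 : ‖h y - h t‖ < d / 2 :=
      Set.mem_iInter₂.1 (ht y (by rw [P.eq_one i y hy]; exact one_ne_zero)) h hh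
    have h3 := norm_sub_le_norm_sub_add_norm_sub (h x) (h t) (h y)
    rw [norm_sub_rev (h t)] at h3
    linarith
  choose m hm hmK hmμ using fun i =>
    exists_probabilityMeasure_restrict μ (P.isCompact_K i).measurableSet (P.nonempty_K i)
  have hcl : ∀ h ∈ s, ∀ i x, P.φ i x ≠ 0 → ‖h x - sampling 𝕜 m h i‖ ≤ d := fun h hh i x hx =>
    norm_sub_sampling_le m ((hmK i).mono fun y hy => hosc h hh i x y hx hy)
  refine ⟨ι, inferInstance, sampling 𝕜 m, P.synthesis 𝕜, norm_sampling_le m, P.norm_synthesis_le,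
    fun u => ?_, fun h hh => ?_, fun h hh w hw => ?_⟩
  · ext i
    rw [sampling_apply, integral_congr_ae ((hmK i).mono fun x hx => P.synthesis_apply_of_mem u hx)]
    simp
  · exact (P.norm_sub_synthesis_le hd0.le (hcl h hh) (hoff h hh)).trans hdδ
  · refine (P.norm_integral_mul_le hC hd0.le (hM h hh) hPκ (c := sampling 𝕜 m h)
      (fun i x hx => hcl h hh i x (by rw [P.eq_one i x hx]; exact one_ne_zero)) (hoff h hh)
      fun i => ?_).trans ?_
    · rw [hmμ i, integral_smul_measure, ← sampling_apply, hw]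
      simp
    · exact mul_le_mul_of_nonneg_right (by linarith) (norm_nonneg w)

/-- A compact operator on `C₀(L)` and a function `x₀` are almost preserved by a contractive projection
of `C₀(L)` that factors through `ℓ_∞^ι` with `ι` finite. -/
theorem IsCompactOperator.exists_pi_factorization [T2Space L] [LocallyCompactSpace L]
    {Y : Type*} [NormedAddCommGroup Y] [NormedSpace 𝕜 Y]
    {T : C₀(L, 𝕜) →L[𝕜] Y} (hT : IsCompactOperator T) (x₀ : C₀(L, 𝕜)) {δ : ℝ} (hδ : 0 < δ) :
    ∃ (ι : Type) (_ : Fintype ι) (Q : C₀(L, 𝕜) →L[𝕜] (ι → 𝕜)) (J : (ι → 𝕜) →L[𝕜] C₀(L, 𝕜)),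
      ‖Q‖ ≤ 1 ∧ ‖J‖ ≤ 1 ∧ (∀ u, Q (J u) = u) ∧
      ‖x₀ - J (Q x₀)‖ ≤ δ ∧ ‖T ∘L J ∘L Q - T‖ ≤ δ := by
  classical
  let _ : MeasurableSpace L := borel L
  have _ : BorelSpace L := ⟨rfl⟩
  -- Three errors of size `δ / 6` for vectors in the unit ball; the vectors `f - J (Q f)` lie in
  -- the ball of radius two.
  obtain ⟨s, hs⟩ := hT.exists_finset_functional (δ := δ / 6) (by positivity)
  obtain ⟨μ, _, _, hμ⟩ := exists_measure_dominating s
  have hdens : ∀ F : s, ∃ h : C₀(L, 𝕜), ∀ g : C₀(L, 𝕜), ‖g‖ ≤ 1 →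
      ‖F.1 g - ∫ x, h x * g x ∂μ‖ ≤ δ / 6 := fun F =>
    exists_approx_density (hμ F.1 F.2) (by positivity)
  choose h hh using hdens
  obtain ⟨ι, _, Q, J, hQ, hJ, hQJ, hfix, hint⟩ :=
    _root_.exists_pi_factorization μ (insert x₀ (Finset.univ.image h)) (δ := δ / 6) (by positivity)
  let Q' : C₀(L, 𝕜) →L[𝕜] (ι → 𝕜) := Q.mkContinuous 1 fun f => by rw [one_mul]; exact hQ f
  let J' : (ι → 𝕜) →L[𝕜] C₀(L, 𝕜) := J.mkContinuous 1 fun u => by rw [one_mul]; exact hJ u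
  refine ⟨ι, inferInstance, Q', J', Q.mkContinuous_norm_le zero_le_one _,
    J.mkContinuous_norm_le zero_le_one _, hQJ, ?_, ?_⟩
  · exact (hfix x₀ (Finset.mem_insert_self _ _)).trans (by linarith)
  have hker : ∀ w, Q w = 0 → ‖w‖ ≤ 1 → ‖T w‖ ≤ δ / 2 := fun w hw hw1 => by
    obtain ⟨F, hF, hTF⟩ := hs w hw1
    have h1 := hh ⟨F, hF⟩ w hw1
    have h2 := hint (h ⟨F, hF⟩)
      (Finset.mem_insert_of_mem (Finset.mem_image_of_mem h (Finset.mem_univ _))) w hw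
    have h3 := norm_le_norm_add_norm_sub' (F w) (∫ x, h ⟨F, hF⟩ x * w x ∂μ)
    have h4 : δ / 6 * ‖w‖ ≤ δ / 6 := mul_le_of_le_one_right (by positivity) hw1
    simp only at h1
    linarith
  refine ContinuousLinearMap.opNorm_le_of_unit_norm hδ.le fun f hf => ?_
  have hQw : Q (J (Q f) - f) = 0 := by rw [map_sub, hQJ, sub_self]
  have hw : ‖J (Q f) - f‖ ≤ 2 := by
    linarith [norm_sub_le (J (Q f)) f, hJ (Q f), hQ f]
  have hhalf : ‖((1 / 2 : ℝ) : 𝕜)‖ = 1 / 2 := by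
    rw [RCLike.norm_ofReal, abs_of_pos one_half_pos]
  have h1 := hker (((1 / 2 : ℝ) : 𝕜) • (J (Q f) - f)) (by rw [map_smul, hQw, smul_zero])
    (by rw [norm_smul, hhalf]; linarith)
  rw [map_smul, norm_smul, hhalf, map_sub] at h1
  change ‖T (J (Q f)) - T f‖ ≤ δ
  linarith

end

end

/-! ### The property for `(C₀(L), Y)` -/

theorem theorem3p1 {𝕜 : Type*} [RCLike 𝕜]
    (L : Type*) [TopologicalSpace L] [LocallyCompactSpace L] [T2Space L]
    (Y : Type*) [NormedAddCommGroup Y] [NormedSpace 𝕜 Y] [CompleteSpace Y]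
    (h : HasBPBpCompact 𝕜 (c0 𝕜) Y) :
    HasBPBpCompact 𝕜 C₀(L, 𝕜) Y := by
  intro ε hε
  obtain ⟨η, hη, H⟩ := h.exists_pi (half_pos hε)
  refine ⟨η / 2, half_pos hη, fun T x₀ hT hT1 hx₀ hTx => ?_⟩
  have hδ : 0 < min (ε / 2) (η / 2) := by positivity
  obtain ⟨ι, _, Q, J, hQ, hJ, hQJ, hfix, hTJQ⟩ := hT.exists_pi_factorization x₀ hδ
  have hδε := min_le_left (ε / 2) (η / 2)
  have hδη := min_le_right (ε / 2) (η / 2)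
  have hTx' : 1 - η < ‖(T ∘L J) (Q x₀)‖ := by
    have h1 : ‖T x₀‖ ≤ ‖T (J (Q x₀))‖ + ‖(T ∘L J ∘L Q - T) x₀‖ := by
      exact norm_le_norm_add_norm_sub _ _
    have h2 := (T ∘L J ∘L Q - T).le_of_opNorm_le hTJQ x₀
    rw [hx₀, mul_one] at h2
    change 1 - η < ‖T (J (Q x₀))‖
    linarith
  obtain ⟨S, u, hu, hS, hSu, hd, hST⟩ := H ι (T ∘L J) (Q x₀)
    ((T.opNorm_comp_le J).trans (mul_le_one₀ hT1.le (norm_nonneg _) hJ))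
    (by simpa [hx₀] using Q.le_of_opNorm_le hQ x₀) hTx'
  have hSQ : ‖S ∘L Q‖ ≤ 1 := (S.opNorm_comp_le Q).trans (mul_le_one₀ hS (norm_nonneg _) hQ)
  have hJu : ‖J u‖ ≤ 1 := (J.le_of_opNorm_le_of_le hJ hu).trans_eq (one_mul 1)
  have hval : ‖(S ∘L Q) (J u)‖ = 1 := by rw [ContinuousLinearMap.comp_apply, hQJ, hSu]
  have hle : 1 ≤ ‖S ∘L Q‖ * ‖J u‖ := hval.symm.trans_le ((S ∘L Q).le_opNorm (J u))
  refine ⟨S ∘L Q, J u, (isCompactOperator_of_finiteDimensional_domain S).comp_clm Q,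
    le_antisymm hJu ?_, le_antisymm hSQ ?_, hval, ?_, ?_⟩
  · nlinarith [norm_nonneg (J u), norm_nonneg (S ∘L Q)]
  · nlinarith [norm_nonneg (J u), norm_nonneg (S ∘L Q)]
  · have h1 := norm_sub_le_norm_sub_add_norm_sub x₀ (J (Q x₀)) (J u)
    have h2 := J.le_of_opNorm_le hJ (Q x₀ - u)
    rw [map_sub] at h2
    linarith
  · have h1 : S ∘L Q - T = (S - T ∘L J) ∘L Q + (T ∘L J ∘L Q - T) := by
      ext1 f; simp
    have h2 : ‖(S - T ∘L J) ∘L Q‖ ≤ ‖S - T ∘L J‖ :=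
      (ContinuousLinearMap.opNorm_comp_le _ _).trans (mul_le_of_le_one_right (norm_nonneg _) hQ)
    rw [h1]
    refine (norm_add_le _ _).trans_lt ?_
    linarith
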